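/- Let $\tau$ be a cardinal and let $X$ be a topological space of weight $\le\tau$ that is superparacompact: every open covering of $X$ has an open refinement that is star-finite and all of whose components are finite, where a component of a covering is a maximal subfamily any two members of which are joined by a finite chain of members of the subfamily with consecutive members intersecting. Let $B(\tau)=D^{\mathbb N}$ be the Baire space, where $D$ is a discrete space of cardinality $\tau$ (for infinite $\tau$ it has weight $\tau$). A perfect map is a continuous closed map with compact fibres. (i) If $X$ is Čech-complete (i.e. Tychonoff and a $G_\delta$-set in its Stone–Čech compactification $\beta X$), then there is a perfect map of $X$ into $B(\tau)$. (ii) If $X$ is a $p$-space (i.e. Tychonoff, and there are families $\gamma_1,\gamma_2,\dots$ of open subsets of $\beta X$, each covering $X$, with $\bigcap_n\bigcup\{U\in\gamma_n : x\in U\}\subseteq X$ for every $x\in X$), then there is a perfect map of $X$ onto a metrizable space $Y$ of weight $\le\tau$ with covering dimension $\dim Y\le 0$ (so $\dim Y=0$ if $X\neq\emptyset$). (iii) (Corollary 2) In particular, if $X$ is completely metrizable, then there is a perfect map of $X$ into $B(\tau)$. -/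

import Mathlib

open Set TopologicalSpace Topology
open scoped Cardinal

universe u

/-- The weight of a topological space: the least cardinality of a base of its topology. -/
noncomputable def topWeight (X : Type u) [TopologicalSpace X] : Cardinal.{u} :=
  sInf {κ : Cardinal.{u} | ∃ B : Set (Set X), IsTopologicalBasis B ∧ #B = κ}

/-- The (generalized) Baire space `B(τ)`: the countable power of a discrete space of
cardinality `τ`, with the product topology. -/
def GenBaireSpace (τ : Cardinal.{u}) : Type u := ℕ → τ.out

instance instTopologicalSpaceGenBaireSpace (τ : Cardinal.{u}) :
    TopologicalSpace (GenBaireSpace τ) :=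
  @Pi.topologicalSpace ℕ (fun _ => τ.out) (fun _ => ⊥)

/-- `ω` is an open covering of the space `X`. -/
def IsOpenCovering {X : Type u} [TopologicalSpace X] (ω : Set (Set X)) : Prop :=
  (∀ U ∈ ω, IsOpen U) ∧ ⋃₀ ω = univ

/-- `η` is inscribed in (refines) `ω`: every element of `η` lies in some element of `ω`. -/
def IsInscribed {X : Type u} (η ω : Set (Set X)) : Prop :=
  ∀ V ∈ η, ∃ U ∈ ω, V ⊆ U

/-- A system of sets is star-finite if each of its elements meets only finitely many of its
elements. -/
def IsStarFinite {X : Type u} (ω : Set (Set X)) : Prop :=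
  ∀ M ∈ ω, {M' ∈ ω | (M ∩ M').Nonempty}.Finite

/-- A system of sets is enchained if any two of its elements are connected by a finite chain of
its elements in which consecutive sets meet. -/
def IsEnchained {X : Type u} (κ : Set (Set X)) : Prop :=
  ∀ M ∈ κ, ∀ M' ∈ κ,
    Relation.ReflTransGen (fun A B : Set X => A ∈ κ ∧ B ∈ κ ∧ (A ∩ B).Nonempty) M M'

/-- The components (of overlapping) of a system `ω`: its maximal enchained subsystems. -/
def IsOverlapComponent {X : Type u} (ω κ : Set (Set X)) : Prop :=
  Maximal (fun κ' : Set (Set X) => κ' ⊆ ω ∧ IsEnchained κ') κ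

/-- A finite-component open covering: a star-finite open covering all of whose components are
finite. -/
def IsFiniteComponentCovering {X : Type u} [TopologicalSpace X] (ω : Set (Set X)) : Prop :=
  IsOpenCovering ω ∧ IsStarFinite ω ∧ ∀ κ, IsOverlapComponent ω κ → κ.Finite

/-- A space is superparacompact if in every open covering one can inscribe a finite-component
open covering. No separation axiom is included. -/
def IsSuperparacompact (X : Type u) [TopologicalSpace X] : Prop :=
  ∀ ω : Set (Set X), IsOpenCovering ω →
    ∃ η : Set (Set X), IsFiniteComponentCovering η ∧ IsInscribed η ω

/-- A Čech-complete space: a Tychonoff space that is a `G_δ`-set in its Stone–Čech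
compactification. -/
def IsCechComplete (X : Type u) [TopologicalSpace X] : Prop :=
  T35Space X ∧ IsGδ (range (stoneCechUnit : X → StoneCech X))

/-- A `p`-space: a Tychonoff space `X` for which there are families `γ 0, γ 1, …` of open subsets
of the Stone–Čech compactification `βX`, each covering `X`, such that for every point `x` of `X`
the intersection of the stars of `x` with respect to the `γ n` is contained in `X`. -/
def IsPSpace (X : Type u) [TopologicalSpace X] : Prop :=
  T35Space X ∧ ∃ γ : ℕ → Set (Set (StoneCech X)),
    (∀ n, ∀ U ∈ γ n, IsOpen U) ∧
    (∀ n, range (stoneCechUnit : X → StoneCech X) ⊆ ⋃₀ γ n) ∧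
    ∀ x : X, (⋂ n, ⋃₀ {U ∈ γ n | stoneCechUnit x ∈ U}) ⊆
      range (stoneCechUnit : X → StoneCech X)

/-- Covering dimension: `dim Y ≤ n` if in every finite open covering one can inscribe a finite
open covering such that any `n + 2` distinct elements of it have empty intersection. -/
def CoveringDimLE (Y : Type u) [TopologicalSpace Y] (n : ℕ) : Prop :=
  ∀ ω : Set (Set Y), ω.Finite → IsOpenCovering ω →
    ∃ η : Set (Set Y), η.Finite ∧ IsOpenCovering η ∧ IsInscribed η ω ∧
      ∀ s : Finset (Set Y), (s : Set (Set Y)) ⊆ η → s.card = n + 2 →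
        ⋂₀ (s : Set (Set Y)) = ∅

/-!
The only consequence of superparacompactness used is that every open covering `ω` of `X` admits a
partition of `X` into clopen sets (the unions of the components of a finite-component refinement),
each covered by finitely many members of `ω`. Partitions are encoded by locally constant maps. A
clopen partition has at most `τ` pieces, so a sequence of partitions is coded by a continuous map
`f : X → B(τ)`. Properness is tested on ultrafilters: if `f` converges along an ultrafilter `𝒰`,
then `𝒰` contains a piece of each partition, hence, by finiteness, a member of each of the coverings
the partitions come from.

If `X` is the intersection of open sets `G n` of `βX`, use the coverings by open sets whose closure
in `βX` lies in `G n`: the limit of `𝒰` in `βX` then lies in every `G n`, so in `X`. For a complete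
metric, use the coverings by balls of radius `1 / (n + 1)`: then `𝒰` is Cauchy.

For a `p`-space this is not enough, since the star of one point need not control the whole piece
around it. Two facts about the quasi-components of a superparacompact space help: they are compact,
and each has arbitrarily small clopen neighbourhoods, so a system of open sets that swallows every
quasi-component is refined by a clopen partition. From the families `γ n` one obtains upper
semicontinuous symmetric relations `E n` such that an ultrafilter containing all stars `E n x` of a
fixed `x` converges (`IsFeathering`). Partition `X` into clopen pieces each inside the `E n`-star of
some quasi-component. Given an ultrafilter containing all pieces around `x₀`, the quasi-components
serving these pieces accumulate at one quasi-component, which has a point `b` all of whose stars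
`E n b` belong to the ultrafilter (`IsFeathering.exists_le_nhds_of_fibers`). So `f` is perfect onto
its range, a subspace of `B(τ)`, whose weight and dimension are read off from the cylinders.
-/

open Filter

/-! ### Clopen partitions and quasi-components -/

/-- `p` is locally constant, and each of its fibres is covered by finitely many members of `ω`: an
encoding of a partition of `X` into clopen sets by the map sending a point to (a label of) its
piece. -/
def IsFinitelyInscribed {X : Type u} [TopologicalSpace X] {ι : Type u} (p : X → ι)
    (ω : Set (Set X)) : Prop :=
  IsLocallyConstant p ∧ ∀ i, ∃ s ⊆ ω, s.Finite ∧ p ⁻¹' {i} ⊆ ⋃₀ s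

/-- Two members of `ω` that meet: one step of the chains that join members of a component. -/
abbrev OverlapStep {X : Type u} (ω : Set (Set X)) (A B : Set X) : Prop :=
  A ∈ ω ∧ B ∈ ω ∧ (A ∩ B).Nonempty

lemma reflTransGen_overlapStep_symm {X : Type u} {ω : Set (Set X)} {A B : Set X}
    (h : Relation.ReflTransGen (OverlapStep ω) A B) :
    Relation.ReflTransGen (OverlapStep ω) B A :=
  haveI : Std.Symm (OverlapStep ω) := ⟨fun A B h => ⟨h.2.1, h.1, inter_comm A B ▸ h.2.2⟩⟩
  Relation.ReflTransGen.stdSymm.symm _ _ h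

/-- The component of a member `M` of a system `ω`, as the set of all members reachable from `M`. -/
lemma isOverlapComponent_setOf_reflTransGen {X : Type u} {ω : Set (Set X)} {M : Set X}
    (hM : M ∈ ω) :
    IsOverlapComponent ω {N | Relation.ReflTransGen (OverlapStep ω) M N} := by
  refine ⟨⟨fun N hN => ?_, fun A hA B hB => ?_⟩, fun κ hκ hle N hN => ?_⟩
  · rcases Relation.ReflTransGen.cases_tail hN with h | ⟨_, _, h⟩
    · exact h ▸ hM
    · exact h.2.1
  · have hAB : Relation.ReflTransGen (OverlapStep ω) A B :=
      (reflTransGen_overlapStep_symm hA).trans hB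
    clear hB
    induction hAB with
    | refl => exact .refl
    | tail hAC hCB ih => exact ih.tail ⟨hA.trans hAC, (hA.trans hAC).tail hCB, hCB.2.2⟩
  · exact Relation.ReflTransGen.mono (p := OverlapStep ω)
      (fun A B h => ⟨hκ.1 h.1, hκ.1 h.2.1, h.2.2⟩) _ _ (hκ.2 M (hle .refl) N hN)

/-- The unions of the components of a finite-component covering are the pieces of a clopen
partition. -/
lemma IsSuperparacompact.exists_isFinitelyInscribed {X : Type u} [TopologicalSpace X]
    (hX : IsSuperparacompact X) {ω : Set (Set X)} (hω : IsOpenCovering ω) :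
    ∃ (ι : Type u) (p : X → ι), IsFinitelyInscribed p ω := by
  obtain ⟨η, ⟨⟨hηo, hηc⟩, -, hηf⟩, hηω⟩ := hX ω hω
  have hcov : ∀ x, ∃ M ∈ η, x ∈ M := fun x => by
    have : x ∈ ⋃₀ η := hηc ▸ mem_univ x
    simpa using this
  let r : Setoid X :=
    { r := fun x y => ∃ M ∈ η, ∃ N ∈ η, x ∈ M ∧ y ∈ N ∧ Relation.ReflTransGen (OverlapStep η) M N
      iseqv :=
        { refl := fun x => by
            obtain ⟨M, hM, hx⟩ := hcov x
            exact ⟨M, hM, M, hM, hx, hx, .refl⟩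
          symm := fun ⟨M, hM, N, hN, hx, hy, h⟩ =>
            ⟨N, hN, M, hM, hy, hx, reflTransGen_overlapStep_symm h⟩
          trans := fun ⟨M, hM, N, hN, hx, hy, h⟩ ⟨N', hN', K, hK, hy', hz, h'⟩ =>
            ⟨M, hM, K, hK, hx, hz, (h.tail ⟨hN, hN', _, hy, hy'⟩).trans h'⟩ } }
  refine ⟨Quotient r, Quotient.mk r, ?_, fun i => ?_⟩
  · rw [IsLocallyConstant.iff_exists_open]
    intro x
    obtain ⟨M, hM, hx⟩ := hcov x
    exact ⟨M, hηo M hM, hx, fun y hy => Quotient.sound ⟨M, hM, M, hM, hy, hx, .refl⟩⟩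
  · obtain ⟨x, rfl⟩ := Quotient.exists_rep i
    obtain ⟨M, hM, hx⟩ := hcov x
    have hfin := hηf _ (isOverlapComponent_setOf_reflTransGen hM)
    have hsub := (isOverlapComponent_setOf_reflTransGen hM).1.1
    choose! U hU hVU using hηω
    refine ⟨U '' {N | Relation.ReflTransGen (OverlapStep η) M N}, ?_, hfin.image U, fun y hy => ?_⟩
    · rintro _ ⟨N, hN, rfl⟩
      exact hU N (hsub hN)
    · obtain ⟨M', hM', N, hN, hx', hy', h⟩ : r x y := Quotient.exact (Eq.symm hy)
      exact ⟨U N, mem_image_of_mem _ (.head ⟨hM, hM', x, hx, hx'⟩ h), hVU N hN hy'⟩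

/-- The quasi-component of `x`: the intersection of all clopen sets containing `x`. -/
def quasiComponent {X : Type u} [TopologicalSpace X] (x : X) : Set X :=
  {y | ∀ H : Set X, IsClopen H → x ∈ H → y ∈ H}

lemma mem_quasiComponent_self {X : Type u} [TopologicalSpace X] (x : X) :
    x ∈ quasiComponent x := fun _ _ hx => hx

lemma quasiComponent_subset_of_mem {X : Type u} [TopologicalSpace X] {x y : X} {H : Set X}
    (hy : y ∈ quasiComponent x) (hH : IsClopen H) (hyH : y ∈ H) : quasiComponent x ⊆ H := by
  intro z hz
  refine hz H hH ?_
  by_contra hx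
  exact hy Hᶜ hH.compl hx hyH

lemma isClosed_quasiComponent {X : Type u} [TopologicalSpace X] (x : X) :
    IsClosed (quasiComponent x) := by
  have : quasiComponent x = ⋂ (H : Set X) (_ : IsClopen H) (_ : x ∈ H), H := by
    ext y; simp [quasiComponent]
  rw [this]
  exact isClosed_iInter fun H => isClosed_iInter fun hH => isClosed_iInter fun _ => hH.1

lemma IsFinitelyInscribed.isClopen_preimage {X : Type u} [TopologicalSpace X] {ι : Type u}
    {p : X → ι} {ω : Set (Set X)} (h : IsFinitelyInscribed p ω) (i : ι) : IsClopen (p ⁻¹' {i}) :=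
  h.1.isClopen_fiber i

lemma IsSuperparacompact.isCompact_quasiComponent {X : Type u} [TopologicalSpace X]
    (hX : IsSuperparacompact X) (x : X) : IsCompact (quasiComponent x) := by
  refine isCompact_iff_ultrafilter_le_nhds'.2 fun 𝒰 h𝒰 => ?_
  by_contra! hcon
  -- The open sets outside `𝒰` would cover `X`; but the piece of a partition finitely inscribed in
  -- them that contains `x` belongs to `𝒰`.
  obtain ⟨ι, p, hp⟩ := hX.exists_isFinitelyInscribed (ω := {U | IsOpen U ∧ U ∉ 𝒰}) (by
    refine ⟨fun U hU => hU.1, eq_univ_of_forall fun y => ?_⟩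
    by_cases hy : y ∈ quasiComponent x
    · have := hcon y hy
      rw [(nhds_basis_opens y).ge_iff] at this
      push Not at this
      obtain ⟨U, ⟨hyU, hU⟩, hU𝒰⟩ := this
      exact ⟨U, ⟨hU, hU𝒰⟩, hyU⟩
    · exact ⟨(quasiComponent x)ᶜ, ⟨(isClosed_quasiComponent x).isOpen_compl,
        Ultrafilter.compl_notMem_iff.2 h𝒰⟩, hy⟩)
  obtain ⟨s, hsω, hsf, hs⟩ := hp.2 (p x)
  have hmem : ⋃₀ s ∈ 𝒰 :=
    mem_of_superset h𝒰 fun y hy => hs (hy _ (hp.isClopen_preimage (p x)) rfl)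
  obtain ⟨U, hU, hU𝒰⟩ := (Ultrafilter.finite_sUnion_mem_iff hsf).1 hmem
  exact (hsω hU).2 hU𝒰

/-- Clopen sets separate a quasi-component from the complement of an open neighbourhood; in other
words, the decomposition of `X` into quasi-components is upper semicontinuous. -/
lemma IsSuperparacompact.exists_isClopen {X : Type u} [TopologicalSpace X]
    (hX : IsSuperparacompact X) {x : X} {V : Set X} (hV : IsOpen V) (hxV : quasiComponent x ⊆ V) :
    ∃ H, IsClopen H ∧ x ∈ H ∧ H ⊆ V := by
  obtain ⟨ι, p, hp⟩ := hX.exists_isFinitelyInscribed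
    (ω := insert V {U | IsClopen U ∧ x ∉ U}) (by
      refine ⟨?_, eq_univ_of_forall fun y => ?_⟩
      · rintro U (rfl | hU)
        exacts [hV, hU.1.2]
      · by_cases hy : y ∈ V
        · exact ⟨V, mem_insert _ _, hy⟩
        · have : y ∉ quasiComponent x := fun h => hy (hxV h)
          simp only [quasiComponent, mem_ofPred_eq] at this
          push Not at this
          obtain ⟨H, hH, hxH, hyH⟩ := this
          exact ⟨Hᶜ, Or.inr ⟨hH.compl, fun h => h hxH⟩, hyH⟩)
  obtain ⟨s, hsω, hsf, hs⟩ := hp.2 (p x)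
  have hH : IsClopen (⋃ U ∈ s \ {V}, U) := by
    refine hsf.sdiff.isClopen_biUnion fun U hU => ?_
    rcases hsω hU.1 with h | h
    exacts [absurd h hU.2, h.1]
  refine ⟨p ⁻¹' {p x} \ ⋃ U ∈ s \ {V}, U, (hp.isClopen_preimage _).diff hH, ⟨rfl, ?_⟩, ?_⟩
  · simp only [mem_iUnion, not_exists]
    intro U hU hxU
    rcases hsω hU.1 with h | h
    exacts [hU.2 h, h.2 hxU]
  · rintro y ⟨hy, hyU⟩
    obtain ⟨U, hU, hyU'⟩ := hs hy
    by_cases h : U = V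
    · exact h ▸ hyU'
    · exact absurd (mem_biUnion (show U ∈ s \ {V} from ⟨hU, h⟩) hyU') hyU

/-- If each quasi-component lies in a member of a system of open sets, then some clopen partition
is inscribed in that system. -/
lemma IsSuperparacompact.exists_isLocallyConstant_fiber_subset {X : Type u} [TopologicalSpace X]
    (hX : IsSuperparacompact X) (V : X → Set X) (hV : ∀ x, IsOpen (V x))
    (hxV : ∀ x, quasiComponent x ⊆ V x) :
    ∃ (ι : Type u) (p : X → ι), IsLocallyConstant p ∧ ∀ x, ∃ c, p ⁻¹' {p x} ⊆ V c := by
  choose H hH hxH hHV using fun x => hX.exists_isClopen (hV x) (hxV x)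
  obtain ⟨ι, p, hp⟩ := hX.exists_isFinitelyInscribed (ω := range H)
    ⟨by rintro _ ⟨x, rfl⟩; exact (hH x).2,
      eq_univ_of_forall fun x => ⟨H x, mem_range_self x, hxH x⟩⟩
  choose s hsω hsf hs using hp.2
  -- Split each piece according to the finitely many clopen sets that cover it.
  refine ⟨ι × Set (Set X), fun x => (p x, {U ∈ s (p x) | x ∈ U}), ?_, fun x => ?_⟩
  · rw [IsLocallyConstant.iff_eventually_eq]
    intro x
    have h1 : ∀ᶠ y in 𝓝 x, p y = p x := hp.1.eventually_eq x
    have h2 : ∀ᶠ y in 𝓝 x, ∀ U ∈ s (p x), (y ∈ U ↔ x ∈ U) := by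
      rw [eventually_all_finite (hsf _)]
      intro U hU
      obtain ⟨c, rfl⟩ := hsω _ hU
      by_cases hx : x ∈ H c
      · filter_upwards [(hH c).2.mem_nhds hx] with y hy
        simp [hx, hy]
      · filter_upwards [(hH c).compl.2.mem_nhds hx] with y hy
        simpa [hx] using hy
    filter_upwards [h1, h2] with y hy1 hy2
    rw [hy1]
    refine Prod.ext rfl ?_
    ext U
    simp only [mem_ofPred_eq]
    exact and_congr_right fun hU => hy2 U hU
  · obtain ⟨U, hU, hxU⟩ := hs (p x) rfl
    obtain ⟨c, rfl⟩ := hsω _ hU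
    refine ⟨c, fun y hy => hHV c ?_⟩
    have h : {U ∈ s (p y) | y ∈ U} = {U ∈ s (p x) | x ∈ U} := (Prod.ext_iff.1 hy).2
    have : H c ∈ {U ∈ s (p y) | y ∈ U} := by rw [h]; exact ⟨hU, hxU⟩
    exact this.2

/-! ### Maps into Baire spaces -/

lemma exists_isTopologicalBasis_mk_eq_topWeight (X : Type u) [TopologicalSpace X] :
    ∃ B : Set (Set X), IsTopologicalBasis B ∧ #B = topWeight X :=
  csInf_mem (s := {κ : Cardinal.{u} | ∃ B : Set (Set X), IsTopologicalBasis B ∧ #B = κ})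
    ⟨_, _, isTopologicalBasis_opens, rfl⟩

lemma topWeight_le {X : Type u} [TopologicalSpace X] {B : Set (Set X)}
    (hB : IsTopologicalBasis B) : topWeight X ≤ #B :=
  csInf_le' ⟨B, hB, rfl⟩

/-- A clopen partition of `X` has at most `topWeight X` pieces, since each piece contains a
nonempty basic set. -/
lemma IsLocallyConstant.mk_range_le_topWeight {X : Type u} [TopologicalSpace X] {ι : Type u}
    {p : X → ι} (hp : IsLocallyConstant p) : #(range p) ≤ topWeight X := by
  obtain ⟨B, hB, hBX⟩ := exists_isTopologicalBasis_mk_eq_topWeight X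
  rw [← hBX]
  have : ∀ i : range p, ∃ b : B, (b : Set X).Nonempty ∧ (b : Set X) ⊆ p ⁻¹' {i.1} := by
    rintro ⟨_, x, rfl⟩
    obtain ⟨b, hb, hxb, hbp⟩ := hB.exists_subset_of_mem_open (show x ∈ p ⁻¹' {p x} from rfl)
      (hp.isOpen_fiber _)
    exact ⟨⟨b, hb⟩, ⟨x, hxb⟩, hbp⟩
  choose b hbne hb using this
  refine Cardinal.mk_le_of_injective (f := b) fun i j hij => ?_
  obtain ⟨x, hx⟩ := hbne i
  exact Subtype.ext ((hb i hx).symm.trans (hb j (hij ▸ hx)))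

lemma IsLocallyConstant.exists_comp_eq_imp {X : Type u} [TopologicalSpace X] {ι : Type u}
    {p : X → ι} (hp : IsLocallyConstant p) {τ : Cardinal.{u}} (hτ : topWeight X ≤ τ) :
    ∃ g : X → τ.out, IsLocallyConstant g ∧ ∀ x y, g x = g y → p x = p y := by
  have h : #(range p) ≤ #τ.out := by
    rw [Cardinal.mk_out]; exact hp.mk_range_le_topWeight.trans hτ
  obtain ⟨e⟩ := h
  refine ⟨fun x => e ⟨p x, mem_range_self x⟩, ?_, fun x y hxy => ?_⟩
  · rw [IsLocallyConstant.iff_eventually_eq]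
    intro x
    filter_upwards [hp.eventually_eq x] with y hy
    simp only [hy]
  · exact congrArg Subtype.val (e.injective hxy)

/-- A sequence of clopen partitions of `X` is coded by a continuous map into `B(τ)`. -/
lemma exists_continuous_genBaireSpace {X : Type u} [TopologicalSpace X] {τ : Cardinal.{u}}
    (hτ : topWeight X ≤ τ) {ι : ℕ → Type u} (p : ∀ n, X → ι n)
    (hp : ∀ n, IsLocallyConstant (p n)) :
    ∃ f : X → GenBaireSpace τ, Continuous f ∧ ∀ n x y, f x n = f y n → p n x = p n y := by
  choose g hg hgp using fun n => (hp n).exists_comp_eq_imp hτ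
  let _ : TopologicalSpace τ.out := ⊥
  exact ⟨fun x n => g n x, continuous_pi fun n => (hg n).continuous, fun n x y => hgp n x y⟩

instance (τ : Cardinal.{u}) : MetrizableSpace (GenBaireSpace τ) := by
  let _ : TopologicalSpace τ.out := ⊥
  have : DiscreteTopology τ.out := ⟨rfl⟩
  exact inferInstanceAs (MetrizableSpace (ℕ → τ.out))

lemma GenBaireSpace.eventually_apply_eq {X : Type u} {τ : Cardinal.{u}} {f : X → GenBaireSpace τ}
    {l : Filter X} {y : GenBaireSpace τ} (h : Tendsto f l (𝓝 y)) (n : ℕ) :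
    ∀ᶠ x in l, f x n = y n := by
  let _ : TopologicalSpace τ.out := ⊥
  have : DiscreteTopology τ.out := ⟨rfl⟩
  have h' := tendsto_pi_nhds.1 (show Tendsto (β := ℕ → τ.out) f l (𝓝 y) from h) n
  exact tendsto_pure.1 (by rwa [nhds_discrete] at h')

/-- If `X` has a complete sequence of open coverings, in the sense that every ultrafilter containing
a member of each of them converges, then clopen partitions finitely inscribed in them give a perfect
map. -/
lemma IsSuperparacompact.exists_isProperMap_genBaireSpace {X : Type u} [TopologicalSpace X]
    (hX : IsSuperparacompact X) {τ : Cardinal.{u}} (hτ : topWeight X ≤ τ)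
    (ω : ℕ → Set (Set X)) (hω : ∀ n, IsOpenCovering (ω n))
    (hconv : ∀ 𝒰 : Ultrafilter X, (∀ n, ∃ U ∈ ω n, U ∈ 𝒰) → ∃ x, (𝒰 : Filter X) ≤ 𝓝 x) :
    ∃ f : X → GenBaireSpace τ, IsProperMap f := by
  choose ι p hp using fun n => hX.exists_isFinitelyInscribed (hω n)
  obtain ⟨f, hf, hfp⟩ := exists_continuous_genBaireSpace hτ p fun n => (hp n).1
  refine ⟨f, isProperMap_iff_ultrafilter_of_t2.2 ⟨hf, fun 𝒰 y hy => hconv 𝒰 fun n => ?_⟩⟩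
  have hn : {x | f x n = y n} ∈ 𝒰 := GenBaireSpace.eventually_apply_eq hy n
  obtain ⟨x, hx⟩ := 𝒰.nonempty_of_mem hn
  obtain ⟨s, hsω, hsf, hs⟩ := (hp n).2 (p n x)
  have : ⋃₀ s ∈ 𝒰 := mem_of_superset hn fun x' hx' => hs (hfp n x' x (hx'.trans hx.symm))
  obtain ⟨U, hU, hU𝒰⟩ := (Ultrafilter.finite_sUnion_mem_iff hsf).1 this
  exact ⟨U, hsω hU, hU𝒰⟩

/-! ### Čech-complete and completely metrizable spaces -/

/-- The open sets whose closure in `βX` lies in a member of `γ` cover `X` if `γ` does. -/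
lemma isOpenCovering_closure_image_stoneCechUnit {X : Type u} [TopologicalSpace X]
    {γ : Set (Set (StoneCech X))} (hγo : ∀ V ∈ γ, IsOpen V)
    (hγ : range (stoneCechUnit : X → StoneCech X) ⊆ ⋃₀ γ) :
    IsOpenCovering {U : Set X | IsOpen U ∧ ∃ V ∈ γ, closure (stoneCechUnit '' U) ⊆ V} := by
  refine ⟨fun U hU => hU.1, eq_univ_of_forall fun x => ?_⟩
  obtain ⟨V, hV, hxV⟩ := hγ (mem_range_self x)
  obtain ⟨W, hW, hWc, hWV⟩ := exists_mem_nhds_isClosed_subset ((hγo V hV).mem_nhds hxV)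
  refine ⟨stoneCechUnit ⁻¹' interior W,
    ⟨isOpen_interior.preimage continuous_stoneCechUnit, V, hV, ?_⟩, mem_interior_iff_mem_nhds.2 hW⟩
  exact (closure_minimal ((image_preimage_subset _ _).trans interior_subset) hWc).trans hWV

/-- An ultrafilter on a Tychonoff space `X` converges in `X` if its limit in `βX`, which belongs to
the closure of each of its members, is in `X`. -/
lemma Ultrafilter.exists_le_nhds_of_stoneCech {X : Type u} [TopologicalSpace X] [T35Space X]
    (𝒰 : Ultrafilter X)
    (h : ∀ z, (∀ S ∈ 𝒰, z ∈ closure (stoneCechUnit '' S)) →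
      z ∈ range (stoneCechUnit : X → StoneCech X)) :
    ∃ x, (𝒰 : Filter X) ≤ 𝓝 x := by
  have hz := (𝒰.map stoneCechUnit).le_nhds_lim
  obtain ⟨x, hx⟩ := h _ fun S hS => mem_closure_iff_ultrafilter.2
    ⟨𝒰.map stoneCechUnit, image_mem_map hS, hz⟩
  rw [← hx, Ultrafilter.coe_map] at hz
  exact ⟨x, by rw [isEmbedding_stoneCechUnit.nhds_eq_comap]; exact map_le_iff_le_comap.1 hz⟩

lemma IsSuperparacompact.exists_isProperMap_of_isCechComplete {X : Type u} [TopologicalSpace X]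
    (hX : IsSuperparacompact X) {τ : Cardinal.{u}} (hτ : topWeight X ≤ τ)
    (hC : IsCechComplete X) : ∃ f : X → GenBaireSpace τ, IsProperMap f := by
  obtain ⟨_, hG⟩ := hC
  obtain ⟨G, hGo, hGX⟩ := isGδ_iff_eq_iInter_nat.1 hG
  refine hX.exists_isProperMap_genBaireSpace hτ _
    (fun n => isOpenCovering_closure_image_stoneCechUnit (γ := {G n}) ?_ ?_) fun 𝒰 h𝒰 => ?_
  · rintro _ rfl; exact hGo n
  · rw [sUnion_singleton, hGX]; exact iInter_subset _ n
  · refine 𝒰.exists_le_nhds_of_stoneCech fun z hz => ?_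
    rw [hGX, mem_iInter]
    intro n
    obtain ⟨U, ⟨-, _, rfl, hUG⟩, hU⟩ := h𝒰 n
    exact hUG (hz U hU)

lemma IsSuperparacompact.exists_isProperMap_of_isCompletelyMetrizableSpace {X : Type u}
    [TopologicalSpace X] (hX : IsSuperparacompact X) {τ : Cardinal.{u}} (hτ : topWeight X ≤ τ)
    [IsCompletelyMetrizableSpace X] : ∃ f : X → GenBaireSpace τ, IsProperMap f := by
  let _ := upgradeIsCompletelyMetrizable X
  have hpos : ∀ n : ℕ, (0 : ℝ) < 1 / (n + 1) := fun n => Nat.one_div_pos_of_nat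
  refine hX.exists_isProperMap_genBaireSpace hτ
    (fun n => range fun x : X => Metric.ball x (1 / (n + 1))) (fun n => ⟨?_, ?_⟩) fun 𝒰 h𝒰 => ?_
  · rintro _ ⟨x, rfl⟩; exact Metric.isOpen_ball
  · exact eq_univ_of_forall fun x => ⟨_, mem_range_self x, Metric.mem_ball_self (hpos n)⟩
  · refine cauchy_iff_exists_le_nhds.1 (Metric.cauchy_iff.2 ⟨𝒰.neBot, fun ε hε => ?_⟩)
    obtain ⟨n, hn⟩ := exists_nat_one_div_lt (half_pos hε)
    obtain ⟨_, ⟨x, rfl⟩, hx⟩ := h𝒰 n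
    refine ⟨_, hx, fun a ha b hb => ?_⟩
    have := dist_triangle_right a b x
    rw [Metric.mem_ball] at ha hb
    linarith

/-! ### `p`-spaces -/

/-- A feathering: a decreasing sequence of reflexive symmetric relations on `X`, whose sets `E n x`
play the role of stars of `x` in finer and finer locally finite closed coverings: they are upper
semicontinuous in `x`, and an ultrafilter that contains all `E n x` for a fixed `x` converges. -/
structure IsFeathering {X : Type u} [TopologicalSpace X] (E : ℕ → X → X → Prop) : Prop where
  refl : ∀ n x, E n x x
  symm : ∀ n x y, E n x y → E n y x
  anti : ∀ m n x y, m ≤ n → E n x y → E m x y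
  eventually_imp : ∀ n x, ∀ᶠ x' in 𝓝 x, ∀ y, E n x' y → E n x y
  exists_le_nhds : ∀ (x : X) (𝒰 : Ultrafilter X), (∀ n, ∀ᶠ y in (𝒰 : Filter X), E n x y) →
    ∃ x', (𝒰 : Filter X) ≤ 𝓝 x'

/-- The relation "`x` and `y` lie in the same piece of a clopen partition and in the closure of
the same member of a finite open covering of that piece", with the partition chosen finitely
inscribed in the open sets whose closures in `βX` refine `γ`, is upper semicontinuous, and the
closure in `βX` of the set of points related to `x` is contained in the star of `x`. -/
lemma IsSuperparacompact.exists_relation_subordinate {X : Type u} [TopologicalSpace X]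
    (hX : IsSuperparacompact X) {γ : Set (Set (StoneCech X))} (hγo : ∀ V ∈ γ, IsOpen V)
    (hγ : range (stoneCechUnit : X → StoneCech X) ⊆ ⋃₀ γ) :
    ∃ E : X → X → Prop, (∀ x, E x x) ∧ (∀ x y, E x y → E y x) ∧
      (∀ x, ∀ᶠ x' in 𝓝 x, ∀ y, E x' y → E x y) ∧
      ∀ x, closure (stoneCechUnit '' {y | E x y}) ⊆ ⋃₀ {U ∈ γ | stoneCechUnit x ∈ U} := by
  obtain ⟨ι, p, hp⟩ :=
    hX.exists_isFinitelyInscribed (isOpenCovering_closure_image_stoneCechUnit hγo hγ)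
  choose s hsω hsf hs using hp.2
  refine ⟨fun x y => p x = p y ∧ ∃ U ∈ s (p x), x ∈ closure U ∧ y ∈ closure U, fun x => ?_,
    fun x y => ?_, fun x => ?_, fun x => ?_⟩
  · obtain ⟨U, hU, hxU⟩ := hs (p x) rfl
    exact ⟨rfl, U, hU, subset_closure hxU, subset_closure hxU⟩
  · rintro ⟨hxy, U, hU, hx, hy⟩
    exact ⟨hxy.symm, U, hxy ▸ hU, hy, hx⟩
  · have h : ∀ᶠ x' in 𝓝 x, ∀ U ∈ s (p x), x' ∈ closure U → x ∈ closure U := by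
      rw [eventually_all_finite (hsf _)]
      intro U _
      by_cases hxU : x ∈ closure U
      · exact Eventually.of_forall fun _ _ => hxU
      · filter_upwards [isClosed_closure.isOpen_compl.mem_nhds hxU] with x' hx' h
        exact absurd h hx'
    filter_upwards [h, hp.1.eventually_eq x] with x' hx' hpx' y ⟨hxy, U, hU, hxU, hyU⟩
    rw [hpx'] at hxy hU
    exact ⟨hxy, U, hU, hx' U hU hxU, hyU⟩
  · have hsub : {y | p x = p y ∧ ∃ U ∈ s (p x), x ∈ closure U ∧ y ∈ closure U} ⊆
        ⋃ U ∈ {U ∈ s (p x) | x ∈ closure U}, closure U := by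
      rintro y ⟨-, U, hU, hx, hy⟩
      exact mem_biUnion (show U ∈ {U ∈ s (p x) | x ∈ closure U} from ⟨hU, hx⟩) hy
    have hcl : ∀ U : Set X, stoneCechUnit '' closure U ⊆ closure (stoneCechUnit '' U) :=
      fun U => image_closure_subset_closure_image continuous_stoneCechUnit
    refine (closure_mono (image_mono hsub)).trans ?_
    rw [image_iUnion₂, ((hsf _).subset fun U hU => hU.1).closure_biUnion]
    refine iUnion₂_subset fun U hU z hz => ?_
    obtain ⟨-, V, hV, hUV⟩ := hsω _ hU.1
    exact ⟨V, ⟨hV, hUV (hcl U (mem_image_of_mem _ hU.2))⟩,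
      hUV (closure_minimal (hcl U) isClosed_closure hz)⟩

lemma IsSuperparacompact.exists_isFeathering {X : Type u} [TopologicalSpace X]
    (hX : IsSuperparacompact X) (hP : IsPSpace X) : ∃ E : ℕ → X → X → Prop, IsFeathering E := by
  obtain ⟨_, γ, hγo, hγ, hγX⟩ := hP
  choose E hrefl hsymm hev hcl using fun n => hX.exists_relation_subordinate (hγo n) (hγ n)
  refine ⟨fun n x y => ∀ m ≤ n, E m x y, fun n x m _ => hrefl m x,
    fun n x y h m hm => hsymm m x y (h m hm), fun m n x y hmn h k hk => h k (hk.trans hmn),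
    fun n x => ?_, fun x 𝒰 h𝒰 => 𝒰.exists_le_nhds_of_stoneCech fun z hz => hγX x ?_⟩
  · have := (eventually_all_finite (finite_Iic n)).2 fun m (_ : m ∈ Iic n) => hev m x
    filter_upwards [this] with x' hx' y hy m hm
    exact hx' m hm y (hy m hm)
  · refine mem_iInter.2 fun n => hcl n x (hz _ ?_)
    filter_upwards [h𝒰 n] with y hy using hy n le_rfl

/-- If each piece of the partition `p n` lies in the `E n`-star of some quasi-component, then an
ultrafilter that contains, for every `n`, the piece of `p n` around a fixed point `x₀` converges.
The quasi-components may vary with `n`; the stars of `x₀` meet them, so they accumulate at a single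
quasi-component, and compactness of the latter yields a point all of whose stars are in the
ultrafilter. -/
lemma IsFeathering.exists_le_nhds_of_fibers {X : Type u} [TopologicalSpace X]
    (hX : IsSuperparacompact X) {E : ℕ → X → X → Prop} (hE : IsFeathering E) {ι : ℕ → Type u}
    {p : ∀ n, X → ι n}
    (hpE : ∀ n x, ∃ c, p n ⁻¹' {p n x} ⊆ {y | ∃ d ∈ quasiComponent c, E n d y})
    (𝒰 : Ultrafilter X) (x₀ : X) (h𝒰 : ∀ n, p n ⁻¹' {p n x₀} ∈ 𝒰) :
    ∃ x, (𝒰 : Filter X) ≤ 𝓝 x := by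
  choose c hc using fun n => hpE n x₀
  choose c' hc' hc'x using fun n => hc n (show x₀ ∈ p n ⁻¹' {p n x₀} from rfl)
  -- The quasi-component of `c n` has a point `d n` whose `E n`-star is in `𝒰`: a limit along `𝒰`
  -- of points of that compact set that are `E n`-related to the points of the piece.
  have hd : ∀ n, ∃ d ∈ quasiComponent (c n), ∀ᶠ y in (𝒰 : Filter X), E n d y := by
    intro n
    have hcn : ∀ y, p n y = p n x₀ → ∃ d ∈ quasiComponent (c n), E n d y := fun y hy => hc n hy
    choose! g hg hgE using hcn
    obtain ⟨d, hd, hgd⟩ := isCompact_iff_ultrafilter_le_nhds'.1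
      (hX.isCompact_quasiComponent (c n)) (𝒰.map g)
      (mem_of_superset (h𝒰 n) hg : g ⁻¹' quasiComponent (c n) ∈ 𝒰)
    refine ⟨d, hd, ?_⟩
    filter_upwards [h𝒰 n, hgd (hE.eventually_imp n d)] with y hy hy'
    exact hy' y (hgE y hy)
  choose d hdc hdE using hd
  -- The points `c' n` of the same quasi-components lie in the stars of `x₀`, so they converge
  -- along an ultrafilter on `ℕ` to some `a`.
  obtain ⟨a, ha⟩ := hE.exists_le_nhds x₀ ((hyperfilter ℕ).map c') fun n => by
    have : ∀ᶠ k in (hyperfilter ℕ : Filter ℕ), n ≤ k :=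
      Nat.hyperfilter_le_atTop (eventually_ge_atTop n)
    refine this.mono fun k hk => ?_
    exact hE.symm _ _ _ (hE.anti n k _ _ hk (hc'x k))
  -- By upper semicontinuity of the decomposition, the `d n` are eventually in each open set that
  -- contains the quasi-component of `a`.
  have hda : ∀ V, IsOpen V → quasiComponent a ⊆ V →
      ∀ᶠ k in (hyperfilter ℕ : Filter ℕ), d k ∈ V := by
    intro V hV haV
    obtain ⟨H, hH, haH, hHV⟩ := hX.exists_isClopen hV haV
    have : ∀ᶠ k in (hyperfilter ℕ : Filter ℕ), c' k ∈ H := ha (hH.2.mem_nhds haH)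
    filter_upwards [this] with k hk
    exact hHV (quasiComponent_subset_of_mem (hc' k) hH hk (hdc k))
  obtain ⟨b, -, hb⟩ : ∃ b ∈ quasiComponent a, Tendsto d (hyperfilter ℕ) (𝓝 b) := by
    by_contra! hcon
    have : ∀ b ∈ quasiComponent a, ∃ U, IsOpen U ∧ b ∈ U ∧
        ∀ᶠ k in (hyperfilter ℕ : Filter ℕ), d k ∉ U := by
      intro b hb
      have h := hcon b hb
      rw [(nhds_basis_opens b).tendsto_right_iff] at h
      push Not at h
      obtain ⟨U, ⟨hbU, hU⟩, hdU⟩ := h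
      exact ⟨U, hU, hbU, Ultrafilter.eventually_not.2 (Ultrafilter.frequently_iff_eventually.not.1
        (by simpa using hdU))⟩
    choose! U hU hbU hdU using this
    obtain ⟨t, hta, ht⟩ := (hX.isCompact_quasiComponent a).elim_nhds_subcover U
      fun b hb => (hU b hb).mem_nhds (hbU b hb)
    have h1 := hda _ (isOpen_biUnion fun b hb => hU b (hta b hb)) ht
    have h2 := (eventually_all_finset t).2 fun b hb => hdU b (hta b hb)
    obtain ⟨k, hk1, hk2⟩ := (h1.and h2).exists
    obtain ⟨b, hb, hkb⟩ := mem_iUnion₂.1 hk1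
    exact hk2 b hb hkb
  refine hE.exists_le_nhds b 𝒰 fun m => ?_
  have hm : ∀ᶠ k in (hyperfilter ℕ : Filter ℕ), m ≤ k :=
    Nat.hyperfilter_le_atTop (eventually_ge_atTop m)
  obtain ⟨k, hmk, hk⟩ := (hm.and (hb.eventually (hE.eventually_imp m b))).exists
  filter_upwards [hdE k] with y hy
  exact hk y (hE.anti m k _ _ hmk hy)

lemma IsSuperparacompact.exists_isProperMap_range {X : Type u} [TopologicalSpace X]
    (hX : IsSuperparacompact X) {τ : Cardinal.{u}} (hτ : topWeight X ≤ τ) (hP : IsPSpace X) :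
    ∃ f : X → GenBaireSpace τ, IsProperMap (rangeFactorization f) := by
  obtain ⟨E, hE⟩ := hX.exists_isFeathering hP
  have hnhds : ∀ n x, {y | E n x y} ∈ 𝓝 x := fun n x => by
    filter_upwards [hE.eventually_imp n x] with y hy using hy y (hE.refl n y)
  choose ι p hp hpE using fun n => hX.exists_isLocallyConstant_fiber_subset
    (fun c => interior {y | ∃ d ∈ quasiComponent c, E n d y}) (fun c => isOpen_interior)
    fun c x hx => mem_interior_iff_mem_nhds.2 (mem_of_superset (hnhds n x) fun y hy => ⟨x, hx, hy⟩)
  obtain ⟨f, hf, hfp⟩ := exists_continuous_genBaireSpace hτ p hp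
  refine ⟨f, isProperMap_iff_ultrafilter_of_t2.2 ⟨hf.rangeFactorization, ?_⟩⟩
  rintro 𝒰 ⟨_, x₀, rfl⟩ h
  have h' : Tendsto f 𝒰 (𝓝 (f x₀)) := (continuous_subtype_val.tendsto _).comp h
  refine hE.exists_le_nhds_of_fibers hX
    (fun n x => (hpE n x).imp fun c hc => hc.trans interior_subset) 𝒰 x₀ fun n => ?_
  filter_upwards [GenBaireSpace.eventually_apply_eq h' n] with x hx using hfp n x x₀ hx

/-! ### Dimension and weight of subspaces of Baire spaces -/

/-- Covering dimension zero for subspaces of `ℕ → D`, with `D` discrete: send each point to a member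
of the covering that contains the trace of the largest possible cylinder around the point; the
fibres of this map are the required disjoint refinement. -/
lemma coveringDimLE_zero_of_isInducing {Y : Type u} [TopologicalSpace Y] {D : Type u}
    [TopologicalSpace D] [DiscreteTopology D] {f : Y → ℕ → D} (hf : IsInducing f) :
    CoveringDimLE Y 0 := by
  classical
  intro ω hωf hω
  have hex : ∀ y, ∃ n, ∃ U ∈ ω, f ⁻¹' PiNat.cylinder (f y) n ⊆ U := by
    intro y
    obtain ⟨U, hU, hyU⟩ : ∃ U ∈ ω, y ∈ U := by
      have : y ∈ ⋃₀ ω := hω.2 ▸ mem_univ y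
      simpa using this
    obtain ⟨_, ⟨_, ⟨x, n, rfl⟩, rfl⟩, hy, hsub⟩ :=
      ((PiNat.isTopologicalBasis_cylinders fun _ => D).isInducing hf).exists_subset_of_mem_open
        hyU (hω.1 U hU)
    refine ⟨n, U, hU, ?_⟩
    rwa [PiNat.mem_cylinder_iff_eq.1 hy]
  let N : Y → ℕ := fun y => Nat.find (hex y)
  let S : Y → Set Y := fun y => f ⁻¹' PiNat.cylinder (f y) (N y)
  have hS : ∀ y, ∃ U ∈ ω, S y ⊆ U := fun y => Nat.find_spec (hex y)
  have hyS : ∀ y, y ∈ S y := fun y => PiNat.self_mem_cylinder _ _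
  have hSo : ∀ y, IsOpen (S y) := fun y => (PiNat.isOpen_cylinder _ _ _).preimage hf.continuous
  have hSeq : ∀ y, ∀ z ∈ S y, S z = S y := by
    intro y z hz
    have hcyl : ∀ m ≤ N y, PiNat.cylinder (f z) m = PiNat.cylinder (f y) m := fun m hm =>
      PiNat.mem_cylinder_iff_eq.1 (PiNat.cylinder_anti _ hm hz)
    have hN : N z = N y := by
      refine (Nat.find_eq_iff (hex z)).2 ⟨?_, fun m hm => ?_⟩
      · rw [hcyl _ le_rfl]; exact hS y
      · rw [hcyl _ hm.le]; exact Nat.find_min (hex y) hm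
    simp only [S, hN, hcyl _ le_rfl]
  -- The chosen member depends only on the set `S y`, hence is constant on it.
  choose! g hgω hgS using fun (A : Set Y) (hA : ∃ U ∈ ω, A ⊆ U) => hA
  refine ⟨(fun U => {y | g (S y) = U}) '' ω, hωf.image _, ⟨?_, eq_univ_of_forall fun y => ?_⟩, ?_,
    fun s hs hcard => ?_⟩
  · rintro _ ⟨U, -, rfl⟩
    refine isOpen_iff_forall_mem_open.2 fun y hy => ⟨S y, fun z hz => ?_, hSo y, hyS y⟩
    rw [mem_ofPred_eq, hSeq y z hz]
    exact hy
  · exact ⟨_, mem_image_of_mem _ (hgω _ (hS y)), rfl⟩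
  · rintro _ ⟨U, hU, rfl⟩
    refine ⟨U, hU, fun y hy => ?_⟩
    have := hgS _ (hS y) (hyS y)
    rwa [show g (S y) = U from hy] at this
  · obtain ⟨A, B, hAB, rfl⟩ := Finset.card_eq_two.1 hcard
    obtain ⟨U, -, rfl⟩ := hs (show A ∈ _ by simp)
    obtain ⟨V, -, rfl⟩ := hs (show B ∈ _ by simp)
    refine eq_empty_of_forall_notMem fun y hy => hAB ?_
    have h1 : g (S y) = U := hy {y | g (S y) = U} (by simp)
    have h2 : g (S y) = V := hy {y | g (S y) = V} (by simp)
    rw [← h1, ← h2]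

/-- The cylinders of `ℕ → D` are indexed by the finite sequences in `D`. -/
lemma topWeight_le_of_isInducing {Y : Type u} [TopologicalSpace Y] {D : Type u} [Infinite D]
    [TopologicalSpace D] [DiscreteTopology D] {f : Y → ℕ → D} (hf : IsInducing f) :
    topWeight Y ≤ #D := by
  refine (topWeight_le ((PiNat.isTopologicalBasis_cylinders fun _ => D).isInducing
    hf)).trans ?_
  rw [← Cardinal.mk_list_eq_mk D]
  refine (Cardinal.mk_le_mk_of_subset ?_).trans
    (Cardinal.mk_range_le (f := fun L : List D => f ⁻¹' {y | PiNat.res y L.length = L}))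
  rintro _ ⟨_, ⟨x, n, rfl⟩, rfl⟩
  refine ⟨PiNat.res x n, ?_⟩
  simp only [PiNat.res_length, PiNat.cylinder_eq_res]

lemma finite_of_topWeight_lt_aleph0 {X : Type u} [TopologicalSpace X] [T0Space X]
    (h : topWeight X < Cardinal.aleph0) : Finite X := by
  obtain ⟨B, hB, hBX⟩ := exists_isTopologicalBasis_mk_eq_topWeight X
  rw [← hBX, Cardinal.lt_aleph0_iff_finite] at h
  refine Finite.of_injective (fun x : X => {b : B | x ∈ (b : Set X)}) fun x y hxy => ?_
  refine (hB.inseparable_iff.2 fun b hb => ?_).eq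
  exact Set.ext_iff.1 hxy ⟨b, hb⟩

lemma IsSuperparacompact.exists_isProperMap_of_isPSpace {X : Type u} [TopologicalSpace X]
    (hX : IsSuperparacompact X) {τ : Cardinal.{u}} (hτ : topWeight X ≤ τ) (hP : IsPSpace X) :
    ∃ (Y : Type u) (_ : TopologicalSpace Y) (f : X → Y),
      MetrizableSpace Y ∧ CoveringDimLE Y 0 ∧ topWeight Y ≤ τ ∧
        IsProperMap f ∧ Function.Surjective f := by
  have := hP.1
  rcases lt_or_ge τ Cardinal.aleph0 with hfin | hinf
  · -- `B(τ)` may have larger weight than `τ`, but `X` is finite and discrete.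
    have := finite_of_topWeight_lt_aleph0 (hτ.trans_lt hfin)
    exact ⟨X, inferInstance, id, inferInstance,
      coveringDimLE_zero_of_isInducing (D := X) (f := fun x _ => x) (IsInducing.of_comp
        (g := fun y : ℕ → X => y 0) (by fun_prop) (by fun_prop) IsInducing.id),
      hτ, isProperMap_id, Function.surjective_id⟩
  · obtain ⟨f, hf⟩ := hX.exists_isProperMap_range hτ hP
    let _ : TopologicalSpace τ.out := ⊥
    have : DiscreteTopology τ.out := ⟨rfl⟩
    have : Infinite τ.out := by rw [Cardinal.infinite_iff, Cardinal.mk_out]; exact hinf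
    have hval : IsInducing (Y := ℕ → τ.out) (Subtype.val : range f → GenBaireSpace τ) :=
      IsInducing.subtypeVal
    exact ⟨range f, inferInstance, rangeFactorization f, inferInstance,
      coveringDimLE_zero_of_isInducing hval,
      (topWeight_le_of_isInducing hval).trans_eq (Cardinal.mk_out τ), hf,
      rangeFactorization_surjective⟩

theorem proposition4 (X : Type u) [TopologicalSpace X] (hX : IsSuperparacompact X)
    (τ : Cardinal.{u}) (hτ : topWeight X ≤ τ) :
    (IsCechComplete X → ∃ f : X → GenBaireSpace τ, IsProperMap f) ∧
    (IsPSpace X → ∃ (Y : Type u) (_ : TopologicalSpace Y) (f : X → Y),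
      MetrizableSpace Y ∧ CoveringDimLE Y 0 ∧ topWeight Y ≤ τ ∧
        IsProperMap f ∧ Function.Surjective f) ∧
    (IsCompletelyMetrizableSpace X → ∃ f : X → GenBaireSpace τ, IsProperMap f) := by
  exact ⟨hX.exists_isProperMap_of_isCechComplete hτ, hX.exists_isProperMap_of_isPSpace hτ,
    fun _ => hX.exists_isProperMap_of_isCompletelyMetrizableSpace hτ⟩
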